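/- For a Boolean function $g:\mathbb F_2^N\to\mathbb F_2$ and $x\in\mathbb F_2^N$ let $\mathsf C[g,x]$ be the minimum codimension of a subcube containing $x$ on which $g$ is constant, let $\mathsf C^{\oplus}[g,x]$ be the minimum codimension of an affine subspace containing $x$ on which $g$ is constant, and let $\mathsf{DT}^{\oplus}[g]$ be the least depth of a parity decision tree computing $g$ (a binary tree in which each internal node queries the parity $\bigoplus_{i\in\alpha}x_i$ of a set $\alpha\subseteq[N]$ of input bits and each leaf is labelled by an output bit). For $f:\mathbb F_2^n\to\mathbb F_2$ put $f^{\circ 1}=f$ and, for $k\ge 2$, $f^{\circ k}(y^{(1)},\dots,y^{(n)})=f\big(f^{\circ (k-1)}(y^{(1)}),\dots,f^{\circ (k-1)}(y^{(n)})\big)$, a function on $\mathbb F_2^{n^k}$. Theorem. There is an absolute constant $c>0$ such that for every $n$, every $f:\mathbb F_2^n\to\mathbb F_2$ with $f(\mathbf 0)=0$ that is not a parity function (i.e. $f$ is not of the form $x\mapsto\bigoplus_{i\in\alpha}x_i$ for a set $\alpha\subseteq[n]$, possibly empty), and every integer $k\ge 1$, \[ \mathsf C^{\oplus}[f^{\circ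 k},\mathbf 0]\;\ge\; c\cdot \mathsf C[f,\mathbf 0]^{\,k-1}. \] Moreover $\mathsf{DT}^{\oplus}[f^{\circ k}]\ge \mathsf C^{\oplus}[f^{\circ k},\mathbf 0]$, so the same lower bound holds for $\mathsf{DT}^{\oplus}[f^{\circ k}]$. -/

import Mathlib

/-- The composition `f ∘ g` of Boolean functions: the input consists of one block of
variables (indexed by `κ`) for each variable of `f`, and `g` is applied to every block. -/
def boolComp {ι κ : Type*} (f : (ι → ZMod 2) → ZMod 2) (g : (κ → ZMod 2) → ZMod 2) :
    (ι × κ → ZMod 2) → ZMod 2 :=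
  fun y => f (fun i => g (fun j => y (i, j)))

/-- The `k`-th power of a Boolean function on `n` variables, `f^(k+1) = f ∘ f^k`. Its `n ^ k`
variables are indexed by the words of length `k` over `Fin n`; the first letter is the block
seen by the outermost copy of `f`. The zeroth power is the identity on one bit, so that the first
power is `f`. -/
def boolPow {n : ℕ} (f : (Fin n → ZMod 2) → ZMod 2) :
    (k : ℕ) → ((Fin k → Fin n) → ZMod 2) → ZMod 2
  | 0 => fun y => y Fin.elim0
  | k + 1 => fun y => boolComp f (boolPow f k) (fun p => y (Fin.cons p.1 p.2))

theorem boolPow_one {n : ℕ} (f : (Fin n → ZMod 2) → ZMod 2) (x : Fin n → ZMod 2) :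
    boolPow f 1 (fun w => x (w 0)) = f x := by
  simp [boolPow, boolComp]

/-- `f` is the parity of the variables in some (possibly empty) set `α`. -/
def IsParity {ι : Type*} (f : (ι → ZMod 2) → ZMod 2) : Prop :=
  ∃ α : Finset ι, ∀ x, f x = ∑ i ∈ α, x i

/-- `f` is constant on the set `A`. -/
def ConstantOn {ι : Type*} (f : (ι → ZMod 2) → ZMod 2) (A : Set (ι → ZMod 2)) : Prop :=
  ∀ y ∈ A, ∀ z ∈ A, f y = f z

/-- The subcube, of codimension `J.card`, on which the coordinates in `J` are fixed as in `a`. -/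
def subcube {ι : Type*} (J : Finset ι) (a : ι → ZMod 2) : Set (ι → ZMod 2) :=
  {y | ∀ i ∈ J, y i = a i}

/-- Certificate complexity of `f` at `x`: the least codimension of a subcube through `x` on which
`f` is constant. -/
noncomputable def certComplexity {ι : Type*} [Fintype ι] (f : (ι → ZMod 2) → ZMod 2)
    (x : ι → ZMod 2) : ℕ :=
  sInf {c | ∃ (J : Finset ι) (a : ι → ZMod 2),
    x ∈ subcube J a ∧ ConstantOn f (subcube J a) ∧ J.card = c}

/-- Parity certificate complexity of `f` at `x`: the least codimension of an affine subspace
through `x` on which `f` is constant. -/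
noncomputable def parityCertComplexity {ι : Type*} [Fintype ι] (f : (ι → ZMod 2) → ZMod 2)
    (x : ι → ZMod 2) : ℕ :=
  sInf {c | ∃ H : AffineSubspace (ZMod 2) (ι → ZMod 2),
    x ∈ H ∧ ConstantOn f (H : Set (ι → ZMod 2)) ∧
      Module.finrank (ZMod 2) ((ι → ZMod 2) ⧸ H.direction) = c}

/-- Parity decision trees: internal nodes carry a set of variables, leaves carry a bit. -/
inductive ParityTree (ι : Type*) where
  | leaf (b : ZMod 2) : ParityTree ι
  | node (α : Finset ι) (left right : ParityTree ι) : ParityTree ι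

/-- Evaluation: at a node query the parity of the variables in `α`; go left on `0`, right on `1`. -/
def ParityTree.eval {ι : Type*} : ParityTree ι → (ι → ZMod 2) → ZMod 2
  | .leaf b, _ => b
  | .node α left right, x => if ∑ i ∈ α, x i = 0 then left.eval x else right.eval x

/-- The maximal number of queries on a root-to-leaf path. -/
def ParityTree.depth {ι : Type*} : ParityTree ι → ℕ
  | .leaf _ => 0
  | .node _ left right => max left.depth right.depth + 1

/-- Parity decision tree complexity: the least depth of a parity decision tree computing `f`. -/
noncomputable def parityDT {ι : Type*} [Fintype ι] (f : (ι → ZMod 2) → ZMod 2) : ℕ :=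
  sInf {d | ∃ T : ParityTree ι, (∀ x, T.eval x = f x) ∧ T.depth = d}

/-!
The argument bounds `codim V` from below for every subspace `V` on which `f^k` vanishes, by looking
at the innermost copies of a block function `g` in `f^k = F(g, …, g)`, where `g` is `f` or `f ∘ f`.

Say that `g` has capacity `t` (`HasCapacity`) if every subspace `N` on which `g` is never `1` misses
at least `t` dimensions of some subspace of zeros of `g`. If `g` has capacity `t`, then on `V` the
values of the copies of `g` take all patterns in a subcube through `0` of codimension at most
`codim V / t` (`HasCapacity.exists_subcube`): as long as some copy cannot be switched on alone, `V`
can be enlarged by `t` dimensions inside that block without changing any other block, and the copy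
is given up. As `F` must be constant on that subcube, `codim V ≥ t * C[F, 0]`. Certificate complexity
at `0` is supermultiplicative (`certComplexity_pow_le`), so `C[F, 0]` is at least the respective power
of `C[f, 0]`, and it remains to find capacity.

* If `f` takes the value `1` on the span `U` of its zeros, then `f` has capacity `1`
  (`hasCapacity_one`), and nothing is lost by taking `g = f`.
* Otherwise `f` vanishes exactly on `U`. Let `Q` be the quotient by `U`, let `c = dim Q`, which is at
  least two because `f` is not a parity, and let `m ≥ C[f, 0]` be the number of unit vectors with
  nonzero image in `Q`. If `m ≤ c`, these images are a basis, so `f^k` vanishes exactly on a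
  coordinate subspace of codimension `m ^ k` (`card_pow_le_parityCertComplexity`). If `m > c`, the
  function `f ∘ f` has capacity at least `m / 24` (`hasCapacity_comp_self`), which replaces two of the
  `k` levels by one factor `C[f, 0]` up to a constant. The point is that among the `m` vectors there
  are about `m / (c + 1)` disjoint linear relations (`exists_disjoint_sum_eq_zero`), each of which
  gives zeros of `f ∘ f` with `c` degrees of freedom, and that these zeros span words in `Q` of which
  any subspace without the value `1` contains at most half, because a subspace of `Q ^ s` consisting
  of words of even weight has at most half of the full dimension
  (`two_mul_finrank_le_of_even_weight`).

A parity decision tree of depth `d` is constant on the subspace of inputs following its path for `0`,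
whose codimension is at most `d`.
-/

open Module

/-! ### Capacity of a block function -/

/-- `g` has capacity `t` if `g 0 = 0` and every subspace `N` on which `g` never takes the value `1`
is missed by many zeros of `g`: some subspace `K` of zeros satisfies `dim K - dim (K ∩ N) ≥ t`. -/
def HasCapacity {B : Type*} [AddCommGroup B] [Module (ZMod 2) B] (g : B → ZMod 2) (t : ℕ) : Prop :=
  g 0 = 0 ∧ ∀ N : Submodule (ZMod 2) B, (∃ y ∈ N, g y = 1) ∨
    ∃ K : Submodule (ZMod 2) B, (∀ y ∈ K, g y = 0) ∧
      t + finrank (ZMod 2) ↥(K ⊓ N) ≤ finrank (ZMod 2) K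

theorem ZMod.eq_one_of_ne_zero_two {a : ZMod 2} (h : a ≠ 0) : a = 1 := by
  revert a; decide

section Capacity

variable {ι B : Type*} [Fintype ι] [DecidableEq ι] [AddCommGroup B] [Module (ZMod 2) B] [Finite B]

theorem finrank_sup_map_single (V : Submodule (ZMod 2) (ι → B)) (i : ι)
    (K : Submodule (ZMod 2) B) (t : ℕ)
    (h : t + finrank (ZMod 2) ↥(K ⊓ V.comap (LinearMap.single (ZMod 2) (fun _ => B) i)) ≤
      finrank (ZMod 2) K) :
    t + finrank (ZMod 2) V ≤
      finrank (ZMod 2) ↥(V ⊔ K.map (LinearMap.single (ZMod 2) (fun _ => B) i)) := by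
  set s := LinearMap.single (ZMod 2) (fun _ : ι => B) i with hs
  have inj : Function.Injective s := fun a b h => by simpa [hs] using congrFun h i
  have h1 := Submodule.finrank_sup_add_finrank_inf_eq V (K.map s)
  have h2 : V ⊓ K.map s = (K ⊓ V.comap s).map s := by
    rw [inf_comm, Submodule.map_inf_eq_map_inf_comap]
  have h3 := (Submodule.equivMapOfInjective s inj K).finrank_eq
  have h4 := (Submodule.equivMapOfInjective s inj (K ⊓ V.comap s)).finrank_eq
  rw [h2, ← h3, ← h4] at h1
  omega

/-- If `g` has capacity `t`, then on every subspace `V` of `ι → B` the tuple `(g (y i))ᵢ` takes all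
values in a subcube through `0` of codimension at most `codim V / t`. A coordinate `i` whose block
cannot be given the value `1` independently of the others is put into `J`, at the price of enlarging
`V` by a zero subspace of `g` in block `i`; capacity makes this cost `t` dimensions. -/
theorem HasCapacity.exists_subcube {g : B → ZMod 2} {t : ℕ} (hg : HasCapacity g t)
    (V : Submodule (ZMod 2) (ι → B)) :
    ∃ J : Finset ι, t * J.card + finrank (ZMod 2) V ≤ finrank (ZMod 2) (ι → B) ∧
      ∀ z : ι → ZMod 2, (∀ i ∈ J, z i = 0) → ∃ y ∈ V, ∀ i, g (y i) = z i := by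
  classical
  obtain ⟨hg0, hN⟩ := hg
  -- a maximal set `J` of blocks given up, with the enlarged space `V'`: each `w ∈ V'` vanishing on
  -- `J` agrees outside `J` with some `v ∈ V` whose blocks in `J` are zeros of `g`
  obtain ⟨J, hJ, hmax⟩ := (Set.toFinite {J : Finset ι | ∃ V' : Submodule (ZMod 2) (ι → B),
    t * J.card + finrank (ZMod 2) V ≤ finrank (ZMod 2) V' ∧
    ∀ w ∈ V', (∀ i ∈ J, w i = 0) →
      ∃ v ∈ V, (∀ i ∉ J, v i = w i) ∧ ∀ i ∈ J, g (v i) = 0}).exists_maximal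
    ⟨∅, V, by simp, fun w hw _ => ⟨w, hw, by simp⟩⟩
  obtain ⟨V', hdim, hinv⟩ := hJ
  have key : ∀ i ∉ J, ∃ y, LinearMap.single (ZMod 2) (fun _ : ι => B) i y ∈ V' ∧ g y = 1 := by
    intro i hi
    by_contra hcon
    rcases hN (V'.comap (LinearMap.single (ZMod 2) (fun _ => B) i)) with ⟨y, hy, hy1⟩ | ⟨K, hK, hKt⟩
    · exact hcon ⟨y, hy, hy1⟩
    have hle := hmax (y := insert i J) ?_ (Finset.subset_insert i J)
    · exact hi (hle (Finset.mem_insert_self i J))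
    refine ⟨V' ⊔ K.map (LinearMap.single (ZMod 2) (fun _ => B) i), ?_, ?_⟩
    · have := finrank_sup_map_single V' i K t hKt
      rw [Finset.card_insert_of_notMem hi, mul_add]
      omega
    · intro w hw hw0
      obtain ⟨w', hw', _, ⟨k, hk, rfl⟩, rfl⟩ := Submodule.mem_sup.1 hw
      have hne : ∀ j, j ≠ i → (w' + LinearMap.single (ZMod 2) (fun _ : ι => B) i k) j = w' j := by
        intro j hj
        simp [Pi.single_eq_of_ne hj]
      have hwi : w' i = -k := by
        have := hw0 i (Finset.mem_insert_self i J)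
        simp only [Pi.add_apply, LinearMap.coe_single, Pi.single_eq_same] at this
        exact eq_neg_of_add_eq_zero_left this
      obtain ⟨v, hv, hvJ, hv0⟩ := hinv w' hw' (fun j hj => by
        rw [← hne j (fun h => hi (h ▸ hj))]
        exact hw0 j (Finset.mem_insert_of_mem hj))
      refine ⟨v, hv, fun j hj => ?_, fun j hj => ?_⟩
      · rw [Finset.mem_insert, not_or] at hj
        rw [hne j hj.1, hvJ j hj.2]
      · rcases Finset.mem_insert.1 hj with rfl | hj
        · rw [hvJ j hi, hwi]
          exact hK _ (K.neg_mem hk)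
        · exact hv0 j hj
  choose! y hyV hy1 using key
  refine ⟨J, hdim.trans (Submodule.finrank_le V'), fun z hz => ?_⟩
  set w : ι → B := fun i => if z i = 0 then 0 else y i with hw
  have hwV : w ∈ V' := by
    rw [← Finset.univ_sum_single w]
    refine Submodule.sum_mem _ fun i _ => ?_
    by_cases h : z i = 0
    · simp [hw, h]
    · simpa [hw, h] using hyV i (fun hi => h (hz i hi))
  obtain ⟨v, hv, hvJ, hv0⟩ := hinv w hwV (fun i hi => by simp [hw, hz i hi])
  refine ⟨v, hv, fun i => ?_⟩
  by_cases hi : i ∈ J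
  · rw [hv0 i hi, hz i hi]
  · rw [hvJ i hi]
    by_cases h : z i = 0
    · simp [hw, h, hg0]
    · simp [hw, hy1 i hi, ZMod.eq_one_of_ne_zero_two h]

end Capacity

/-! ### Certificates -/

section Certificates

variable {ι : Type*} [Fintype ι]

theorem certComplexity_le {f : (ι → ZMod 2) → ZMod 2} {x : ι → ZMod 2} (J : Finset ι)
    (h : ∀ z, (∀ i ∈ J, z i = x i) → f z = f x) : certComplexity f x ≤ J.card :=
  Nat.sInf_le ⟨J, x, fun _ _ => rfl, fun y hy z hz => (h y hy).trans (h z hz).symm, rfl⟩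

theorem exists_certificate (f : (ι → ZMod 2) → ZMod 2) (x : ι → ZMod 2) :
    ∃ J : Finset ι, J.card = certComplexity f x ∧ ∀ z, (∀ i ∈ J, z i = x i) → f z = f x := by
  have hne : {c | ∃ (J : Finset ι) (a : ι → ZMod 2),
      x ∈ subcube J a ∧ ConstantOn f (subcube J a) ∧ J.card = c}.Nonempty :=
    ⟨_, Finset.univ, x, fun _ _ => rfl, fun y hy z hz => by
      have : y = z := funext fun i =>
        (hy i (Finset.mem_univ i)).trans (hz i (Finset.mem_univ i)).symm
      rw [this], rfl⟩
  obtain ⟨J, a, hx, hc, hcard⟩ := Nat.sInf_mem hne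
  exact ⟨J, hcard, fun z hz => hc z (fun i hi => (hz i hi).trans (hx i hi)) x hx⟩

theorem parityCertComplexity_le {f : (ι → ZMod 2) → ZMod 2} (V : Submodule (ZMod 2) (ι → ZMod 2))
    (h : ∀ v ∈ V, f v = f 0) :
    parityCertComplexity f 0 ≤ finrank (ZMod 2) ((ι → ZMod 2) ⧸ V) := by
  refine Nat.sInf_le ⟨V.toAffineSubspace, V.zero_mem, fun y hy z hz => ?_, ?_⟩
  · exact (h y hy).trans (h z hz).symm
  · rw [Submodule.toAffineSubspace_direction]

theorem exists_parityCertificate (f : (ι → ZMod 2) → ZMod 2) :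
    ∃ V : Submodule (ZMod 2) (ι → ZMod 2), (∀ v ∈ V, f v = f 0) ∧
      finrank (ZMod 2) ((ι → ZMod 2) ⧸ V) = parityCertComplexity f 0 := by
  have hne : {c | ∃ H : AffineSubspace (ZMod 2) (ι → ZMod 2),
    0 ∈ H ∧ ConstantOn f (H : Set (ι → ZMod 2)) ∧
      finrank (ZMod 2) ((ι → ZMod 2) ⧸ H.direction) = c}.Nonempty :=
    ⟨_, (⊥ : Submodule (ZMod 2) (ι → ZMod 2)).toAffineSubspace, rfl,
      fun y hy z hz => by
        have hy' : y = 0 := hy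
        have hz' : z = 0 := hz
        rw [hy', hz'], rfl⟩
  obtain ⟨H, hH, hc, hd⟩ := Nat.sInf_mem hne
  refine ⟨H.direction, fun v hv => hc v ?_ 0 hH, hd⟩
  simpa using AffineSubspace.vadd_mem_of_mem_direction hv hH

/-- A function that, after a linear change of variables, is `F` applied to blockwise values of a
function of capacity `t`, has parity certificate complexity at least `t` times the certificate
complexity of `F`. -/
theorem HasCapacity.mul_certComplexity_le {X B : Type*} [Fintype X] [AddCommGroup B]
    [Module (ZMod 2) B] [Finite B] {g : B → ZMod 2} {t : ℕ} (hg : HasCapacity g t)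
    (F : (ι → ZMod 2) → ZMod 2) (e : (X → ZMod 2) ≃ₗ[ZMod 2] (ι → B)) :
    t * certComplexity F 0 ≤ parityCertComplexity (fun y => F (fun i => g (e y i))) 0 := by
  classical
  obtain ⟨V, hV, hd⟩ := exists_parityCertificate (fun y => F (fun i => g (e y i)))
  rw [← hd]
  obtain ⟨J, hJ, hz⟩ := hg.exists_subcube (V.map e.toLinearMap)
  have h1 := Submodule.finrank_quotient_add_finrank V
  rw [LinearEquiv.finrank_map_eq e V, ← e.finrank_eq] at hJ
  have hcert : certComplexity F 0 ≤ J.card := by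
    refine certComplexity_le J fun z hzJ => ?_
    obtain ⟨_, ⟨v, hv, rfl⟩, hgv⟩ := hz z hzJ
    have := hV v hv
    have h0 : (fun i => g (e 0 i)) = 0 := by
      funext i; simp [hg.1]
    simp only [h0] at this
    rw [← this]
    exact congrArg F (funext fun i => (hgv i).symm)
  calc t * certComplexity F 0 ≤ t * J.card := Nat.mul_le_mul_left t hcert
    _ ≤ _ := by omega

end Certificates

/-! ### Certificates of compositions and powers -/

/-- Certificate complexity at `0` is supermultiplicative under composition: the blocks on which a
certificate of `f ∘ g` forces the value of `g` form a certificate of `f`, and each of them contains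
a certificate of `g`. -/
theorem certComplexity_mul_le {ι κ : Type*} [Fintype ι] [Fintype κ] (f : (ι → ZMod 2) → ZMod 2)
    (g : (κ → ZMod 2) → ZMod 2) (hg : g 0 = 0) :
    certComplexity f 0 * certComplexity g 0 ≤ certComplexity (boolComp f g) 0 := by
  classical
  obtain ⟨J, hJcard, hJ⟩ := exists_certificate (boolComp f g) 0
  rw [← hJcard]
  let Ji : ι → Finset κ := fun i => Finset.univ.filter fun j => (i, j) ∈ J
  let I : Finset ι := Finset.univ.filter fun i => ∀ y, (∀ j ∈ Ji i, y j = 0) → g y = 0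
  have hI : certComplexity f 0 ≤ I.card := by
    refine certComplexity_le I fun z hz => ?_
    have hex : ∀ i, ∃ y : κ → ZMod 2, (∀ j ∈ Ji i, y j = 0) ∧ g y = z i := by
      intro i
      by_cases hzi : z i = 0
      · exact ⟨0, fun _ _ => rfl, by rw [hg, hzi]⟩
      · have hi : i ∉ I := fun h => hzi (hz i h)
        simp only [I, Finset.mem_filter, Finset.mem_univ, true_and, not_forall] at hi
        obtain ⟨y, hy, hgy⟩ := hi
        exact ⟨y, hy, by rw [ZMod.eq_one_of_ne_zero_two hgy, ZMod.eq_one_of_ne_zero_two hzi]⟩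
    choose y hy hgy using hex
    have h := hJ (fun p => y p.1 p.2) fun p hp => hy p.1 p.2 (by simpa [Ji] using hp)
    have h0 : (fun i : ι => g fun j : κ => (0 : ι × κ → ZMod 2) (i, j)) = 0 := funext fun _ => hg
    simp only [boolComp, h0] at h
    rw [← h]
    exact congrArg f (funext fun i => (hgy i).symm)
  have hJi : ∀ i ∈ I, certComplexity g 0 ≤ (Ji i).card := by
    intro i hi
    refine certComplexity_le (Ji i) fun y hy => ?_
    simp only [I, Finset.mem_filter, Finset.mem_univ, true_and] at hi
    rw [hi y hy, hg]
  have hsum : J.card = ∑ i, (Ji i).card := by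
    rw [Finset.card_eq_sum_card_fiberwise (f := Prod.fst) (t := Finset.univ) (by simp)]
    refine Finset.sum_congr rfl fun i _ => ?_
    refine Finset.card_bij' (fun p _ => p.2) (fun j _ => (i, j)) ?_ ?_ ?_ ?_ <;>
      simp +contextual only [Ji, Finset.mem_filter, Finset.mem_univ, true_and, and_true,
        Prod.forall, implies_true]
    rintro a b ⟨hab, rfl⟩
    exact hab
  calc certComplexity f 0 * certComplexity g 0 ≤ I.card * certComplexity g 0 :=
        Nat.mul_le_mul_right _ hI
    _ = ∑ _i ∈ I, certComplexity g 0 := by rw [Finset.sum_const, smul_eq_mul]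
    _ ≤ ∑ i ∈ I, (Ji i).card := Finset.sum_le_sum hJi
    _ ≤ ∑ i, (Ji i).card := Finset.sum_le_sum_of_subset (Finset.subset_univ I)
    _ = J.card := hsum.symm

theorem certComplexity_le_comp_equiv {X Y : Type*} [Fintype X] [Fintype Y]
    (F : (X → ZMod 2) → ZMod 2) (e : X ≃ Y) :
    certComplexity F 0 ≤ certComplexity (fun y : Y → ZMod 2 => F fun p => y (e p)) 0 := by
  classical
  obtain ⟨J, hJcard, hJ⟩ := exists_certificate (fun y : Y → ZMod 2 => F fun p => y (e p)) 0
  rw [← hJcard, ← Finset.card_map e.symm.toEmbedding]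
  refine certComplexity_le _ fun z hz => ?_
  have h := hJ (fun q => z (e.symm q)) fun q hq =>
    hz (e.symm q) (Finset.mem_map_of_mem e.symm.toEmbedding hq)
  simp only [Equiv.symm_apply_apply] at h
  exact h

section Pow

variable {n : ℕ} (f : (Fin n → ZMod 2) → ZMod 2)

theorem boolPow_zero_arg (h0 : f 0 = 0) : ∀ a, boolPow f a 0 = 0
  | 0 => rfl
  | a + 1 => by
    have h : (fun _ : Fin n => boolPow f a 0) = 0 := funext fun _ => boolPow_zero_arg h0 a
    change f (fun _ : Fin n => boolPow f a 0) = 0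
    rw [h, h0]

theorem certComplexity_pow_le (h0 : f 0 = 0) (a : ℕ) :
    certComplexity f 0 ^ a ≤ certComplexity (boolPow f a) 0 := by
  induction a with
  | zero =>
    obtain ⟨J, hJcard, hJ⟩ := exists_certificate (boolPow f 0) 0
    rw [← hJcard, pow_zero, Nat.one_le_iff_ne_zero, Finset.card_ne_zero]
    by_contra hne
    rw [Finset.not_nonempty_iff_eq_empty] at hne
    exact absurd (hJ 1 (by simp [hne])) (by simp [boolPow])
  | succ a ih =>
    rw [pow_succ']
    exact (Nat.mul_le_mul_left _ ih).trans
      ((certComplexity_mul_le f _ (boolPow_zero_arg f h0 a)).trans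
        (certComplexity_le_comp_equiv _ (Fin.consEquiv fun _ => Fin n)))

/-- A power can also be unfolded at the innermost level. -/
theorem boolPow_succ_snoc (a : ℕ) : ∀ y : (Fin (a + 1) → Fin n) → ZMod 2,
    boolPow f (a + 1) y =
      boolPow f a fun w => f fun j => y (Fin.snoc (α := fun _ => Fin n) w j) := by
  induction a with
  | zero =>
    intro y
    refine congrArg f (funext fun i => congrArg y (funext fun k => ?_))
    rw [Fin.fin_one_eq_zero k]
    simp [Fin.snoc]
  | succ a ih =>
    intro y
    refine congrArg f (funext fun i => ?_)
    change boolPow f (a + 1) (fun w => y (Fin.cons i w)) = _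
    rw [ih]
    simp only [Fin.cons_snoc_eq_snoc_cons]

/-- Inputs of `f^(a+1)` as tuples of blocks of one innermost `f`. -/
def blockEquiv (n a : ℕ) :
    ((Fin (a + 1) → Fin n) → ZMod 2) ≃ₗ[ZMod 2] ((Fin a → Fin n) → Fin n → ZMod 2) where
  toFun y w j := y (Fin.snoc (α := fun _ => Fin n) w j)
  invFun g w := g (Fin.init w) (w (Fin.last a))
  map_add' _ _ := rfl
  map_smul' _ _ := rfl
  left_inv y := funext fun w => congrArg y (Fin.snoc_init_self w)
  right_inv g := funext fun w => funext fun j => by simp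

/-- Inputs of `f^(a+2)` as tuples of blocks of one innermost `f ∘ f`. -/
def doubleBlockEquiv (n a : ℕ) :
    ((Fin (a + 2) → Fin n) → ZMod 2) ≃ₗ[ZMod 2] ((Fin a → Fin n) → Fin n → Fin n → ZMod 2) where
  toFun y w i j := blockEquiv n (a + 1) y (Fin.snoc (α := fun _ => Fin n) w i) j
  invFun g := (blockEquiv n (a + 1)).symm fun w => g (Fin.init w) (w (Fin.last a))
  map_add' _ _ := rfl
  map_smul' _ _ := rfl
  left_inv y := by simp
  right_inv g := funext fun w => funext fun i => by simp

theorem HasCapacity.le_parityCertComplexity_boolPow (h0 : f 0 = 0) {t : ℕ} (hf : HasCapacity f t)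
    (a : ℕ) : t * certComplexity f 0 ^ a ≤ parityCertComplexity (boolPow f (a + 1)) 0 := by
  refine (Nat.mul_le_mul_left t (certComplexity_pow_le f h0 a)).trans ?_
  have h : boolPow f (a + 1) = fun y => boolPow f a fun w => f (blockEquiv n a y w) :=
    funext fun y => boolPow_succ_snoc f a y
  rw [h]
  exact hf.mul_certComplexity_le (boolPow f a) (blockEquiv n a)

theorem HasCapacity.le_parityCertComplexity_boolPow_add_two (h0 : f 0 = 0) {t : ℕ}
    (hf : HasCapacity (fun y : Fin n → Fin n → ZMod 2 => f fun i => f (y i)) t) (a : ℕ) :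
    t * certComplexity f 0 ^ a ≤ parityCertComplexity (boolPow f (a + 2)) 0 := by
  refine (Nat.mul_le_mul_left t (certComplexity_pow_le f h0 a)).trans ?_
  have h : boolPow f (a + 2) =
      fun y => boolPow f a fun w => f fun i => f (doubleBlockEquiv n a y w i) :=
    funext fun y => by rw [boolPow_succ_snoc, boolPow_succ_snoc]; rfl
  rw [h]
  exact hf.mul_certComplexity_le (boolPow f a) (doubleBlockEquiv n a)

end Pow

/-! ### Parity decision trees -/

section Trees

variable {ι : Type*}

/-- The inputs on the path of `T` towards `0`: those that answer every query on it like `0`. -/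
def ParityTree.zeroPath : ParityTree ι → Submodule (ZMod 2) (ι → ZMod 2)
  | .leaf _ => ⊤
  | .node α left _ => (∑ i ∈ α, LinearMap.proj i : (ι → ZMod 2) →ₗ[ZMod 2] ZMod 2).ker ⊓
      left.zeroPath

theorem ParityTree.eval_zeroPath : ∀ (T : ParityTree ι), ∀ v ∈ T.zeroPath, T.eval v = T.eval 0
  | .leaf _, _, _ => rfl
  | .node α left right, v, hv => by
    have h1 : ∑ i ∈ α, v i = 0 := by simpa using hv.1
    simp only [ParityTree.eval, h1, if_true, Pi.zero_apply, Finset.sum_const_zero]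
    exact eval_zeroPath left v hv.2

theorem finrank_le_finrank_ker_inf {E : Type*} [AddCommGroup E] [Module (ZMod 2) E]
    [FiniteDimensional (ZMod 2) E] (φ : E →ₗ[ZMod 2] ZMod 2) (V : Submodule (ZMod 2) E) :
    finrank (ZMod 2) V ≤ finrank (ZMod 2) ↥(φ.ker ⊓ V) + 1 := by
  have h1 := Submodule.finrank_sup_add_finrank_inf_eq φ.ker V
  have h2 := φ.finrank_range_add_finrank_ker
  have h3 := Submodule.finrank_le (φ.ker ⊔ V)
  have h4 := Submodule.finrank_le φ.range
  rw [finrank_self] at h4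
  omega

theorem ParityTree.finrank_le_depth_add [Fintype ι] (T : ParityTree ι) :
    finrank (ZMod 2) (ι → ZMod 2) ≤ T.depth + finrank (ZMod 2) T.zeroPath := by
  induction T with
  | leaf b => rw [zeroPath, depth, zero_add, finrank_top]
  | node α left right ihl _ =>
    have := finrank_le_finrank_ker_inf
      (∑ i ∈ α, LinearMap.proj i : (ι → ZMod 2) →ₗ[ZMod 2] ZMod 2) left.zeroPath
    have h := le_max_left left.depth right.depth
    change _ ≤ max left.depth right.depth + 1 + finrank (ZMod 2) ↥(_ ⊓ left.zeroPath)
    omega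

theorem ParityTree.exists_eval_eq [DecidableEq ι] (S : Finset ι) : ∀ f : (ι → ZMod 2) → ZMod 2,
    (∀ x y, (∀ i ∈ S, x i = y i) → f x = f y) → ∃ T : ParityTree ι, ∀ x, T.eval x = f x := by
  induction S using Finset.induction_on with
  | empty => exact fun f hf => ⟨.leaf (f 0), fun x => hf 0 x (by simp)⟩
  | insert i S _ ih =>
    intro f hf
    have key : ∀ b : ZMod 2, ∃ T : ParityTree ι, ∀ x, T.eval x = f (Function.update x i b) := by
      intro b
      refine ih (fun x => f (Function.update x i b)) fun x y hxy => hf _ _ fun j hj => ?_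
      by_cases hji : j = i
      · simp [hji]
      · simpa [hji] using hxy j ((Finset.mem_insert.1 hj).resolve_left hji)
    obtain ⟨L, hL⟩ := key 0
    obtain ⟨R, hR⟩ := key 1
    refine ⟨.node {i} L R, fun x => ?_⟩
    by_cases h : x i = 0
    · have hx : Function.update x i 0 = x := by rw [← h, Function.update_eq_self]
      simp [ParityTree.eval, h, hL, hx]
    · have hx : Function.update x i 1 = x := by
        rw [← ZMod.eq_one_of_ne_zero_two h, Function.update_eq_self]
      simp [ParityTree.eval, h, hR, hx]

theorem parityCertComplexity_le_parityDT [Fintype ι] (f : (ι → ZMod 2) → ZMod 2) :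
    parityCertComplexity f 0 ≤ parityDT f := by
  classical
  -- without a tree computing `f`, the infimum `parityDT f` would be the junk value `0`
  have hne : {d | ∃ T : ParityTree ι, (∀ x, T.eval x = f x) ∧ T.depth = d}.Nonempty := by
    obtain ⟨T, hT⟩ := ParityTree.exists_eval_eq Finset.univ f fun x y h =>
      congrArg f (funext fun i => h i (Finset.mem_univ i))
    exact ⟨_, T, hT, rfl⟩
  obtain ⟨T, hT, hd⟩ := Nat.sInf_mem hne
  change _ ≤ sInf _
  rw [← hd]
  refine (parityCertComplexity_le T.zeroPath fun v hv => ?_).trans ?_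
  · rw [← hT, ← hT, T.eval_zeroPath v hv]
  · have h1 := T.finrank_le_depth_add
    have h2 := Submodule.finrank_quotient_add_finrank T.zeroPath
    omega

end Trees

/-! ### Linear algebra over the field with two elements -/

section LinearAlgebra

variable {K A B C : Type*} [Field K] [AddCommGroup A] [Module K A] [AddCommGroup B] [Module K B]
  [AddCommGroup C] [Module K C] [FiniteDimensional K B]

theorem finrank_map_add_finrank_inf_ker (g : B →ₗ[K] C) (V : Submodule K B) :
    finrank K (V.map g) + finrank K ↥(V ⊓ g.ker) = finrank K V := by
  have h := (g.domRestrict V).finrank_range_add_finrank_ker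
  rw [LinearMap.range_domRestrict, LinearMap.ker_domRestrict] at h
  have h2 := (Submodule.equivMapOfInjective V.subtype V.injective_subtype
    (g.ker.comap V.subtype)).finrank_eq
  rw [Submodule.map_comap_subtype] at h2
  omega

/-- Rank-nullity for a subspace of the middle term of a left exact sequence. -/
theorem finrank_map_add_finrank_comap (f : A →ₗ[K] B) (g : B →ₗ[K] C)
    (hf : Function.Injective f) (hfg : f.range = g.ker) (V : Submodule K B) :
    finrank K (V.map g) + finrank K (V.comap f) = finrank K V := by
  rw [← finrank_map_add_finrank_inf_ker g V, ← hfg, inf_comm, ← Submodule.map_comap_eq,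
    ← (Submodule.equivMapOfInjective f hf (V.comap f)).finrank_eq]

end LinearAlgebra

section Filtration

variable {K Q : Type*} [Field K] [AddCommGroup Q] [Module K Q] [FiniteDimensional K Q]

theorem finrank_add_le_of_eq_zero_or_eq (hQ : 2 ≤ finrank K Q) (X Y : Submodule K Q)
    (h : ∀ x ∈ X, ∀ y ∈ Y, x = 0 ∨ y = 0 ∨ x = y) : finrank K X + finrank K Y ≤ finrank K Q := by
  by_cases hX : X = ⊥
  · rw [hX, finrank_bot, zero_add]
    exact Submodule.finrank_le Y
  by_cases hY : Y = ⊥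
  · rw [hY, finrank_bot, add_zero]
    exact Submodule.finrank_le X
  obtain ⟨x, hx, hx0⟩ := Submodule.exists_mem_ne_zero_of_ne_bot hX
  obtain ⟨y, hy, hy0⟩ := Submodule.exists_mem_ne_zero_of_ne_bot hY
  have h1 : X ≤ K ∙ y := by
    intro x' hx'
    rcases h x' hx' y hy with rfl | h' | rfl
    · exact Submodule.zero_mem _
    · exact absurd h' hy0
    · exact Submodule.mem_span_singleton_self _
  have h2 : Y ≤ K ∙ x := by
    intro y' hy'
    rcases h x hx y' hy' with h' | rfl | rfl
    · exact absurd h' hx0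
    · exact Submodule.zero_mem _
    · exact Submodule.mem_span_singleton_self _
  have h3 := Submodule.finrank_mono h1
  have h4 := Submodule.finrank_mono h2
  rw [finrank_span_singleton hy0] at h3
  rw [finrank_span_singleton hx0] at h4
  omega

/-- Let the first nonzero entry of each `x ∈ X` and the last nonzero entry of each `y ∈ Y` agree
whenever they stand at the same position. Then `dim X + dim Y ≤ dim Q ^ s`: filtering `X` by the
position of the first nonzero entry and `Y` by that of the last one gives at each position a pair of
subspaces of `Q` to which `finrank_add_le_of_eq_zero_or_eq` applies. -/
theorem finrank_add_le_of_leading_eq_trailing (hQ : 2 ≤ finrank K Q) :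
    ∀ (s : ℕ) (X Y : Submodule K (Fin s → Q)),
      (∀ i, ∀ x ∈ X, ∀ y ∈ Y, (∀ j < i, x j = 0) → (∀ j, i < j → y j = 0) →
        x i = 0 ∨ y i = 0 ∨ x i = y i) →
      finrank K X + finrank K Y ≤ s * finrank K Q := by
  intro s
  induction s with
  | zero =>
    intro X Y _
    rw [finrank_zero_of_subsingleton, finrank_zero_of_subsingleton]
    simp
  | succ s ih =>
    intro X Y h
    let cons0 : (Fin s → Q) →ₗ[K] (Fin (s + 1) → Q) :=
      { toFun := fun x => Fin.cons 0 x
        map_add' := fun x y => by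
          ext j; refine Fin.cases ?_ (fun j => ?_) j <;> simp
        map_smul' := fun r x => by
          ext j; refine Fin.cases ?_ (fun j => ?_) j <;> simp }
    have hcons : ∀ x, cons0 x = Fin.cons 0 x := fun _ => rfl
    let tl : (Fin (s + 1) → Q) →ₗ[K] (Fin s → Q) := LinearMap.funLeft K Q Fin.succ
    let sg := LinearMap.single K (fun _ : Fin (s + 1) => Q) 0
    let pr : (Fin (s + 1) → Q) →ₗ[K] Q := LinearMap.proj 0
    have hX := finrank_map_add_finrank_comap cons0 pr
      (fun x y hxy => funext fun j => by simpa [hcons] using congrFun hxy j.succ) (by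
        ext x
        constructor
        · rintro ⟨y, rfl⟩
          simp [pr, hcons]
        · intro hx
          refine ⟨tl x, funext fun j => ?_⟩
          have hx0 : x 0 = 0 := hx
          refine Fin.cases ?_ (fun j => ?_) j
          · simp [hcons, hx0]
          · simp [hcons, tl, LinearMap.funLeft_apply]) X
    have hY := finrank_map_add_finrank_comap sg tl
      (fun x y hxy => by simpa [sg] using congrFun hxy 0) (by
        ext x
        constructor
        · rintro ⟨y, rfl⟩
          ext j
          simp [sg, tl, LinearMap.funLeft_apply]
        · intro hx
          refine ⟨x 0, funext fun j => ?_⟩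
          refine Fin.cases ?_ (fun j => ?_) j
          · simp [sg]
          · have : x j.succ = 0 := congrFun hx j
            simp [sg, this]) Y
    have h0 := finrank_add_le_of_eq_zero_or_eq hQ (X.map pr) (Y.comap sg) (by
      rintro _ ⟨x, hx, rfl⟩ y hy
      have := h 0 x hx (sg y) hy (fun j hj => absurd hj (Fin.not_lt_zero j))
        (fun j hj => by simp [sg, hj.ne'])
      simpa [sg, pr] using this)
    have h1 := ih (X.comap cons0) (Y.map tl) (by
      rintro i x hx _ ⟨y, hy, rfl⟩ hxi hyi
      have := h i.succ (cons0 x) hx y hy (fun j => by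
        refine Fin.cases (fun _ => ?_) (fun j hj => ?_) j
        · simp [hcons]
        · simpa [hcons] using hxi j (Fin.succ_lt_succ_iff.1 hj)) (fun j => by
        refine Fin.cases (fun hj => ?_) (fun j hj => ?_) j
        · exact absurd hj (Fin.not_lt_zero _)
        · exact hyi j (Fin.succ_lt_succ_iff.1 hj))
      simpa [hcons, tl, LinearMap.funLeft_apply] using this)
    rw [add_mul, one_mul]
    omega

end Filtration

section TwoElements

variable {Q : Type*} [AddCommGroup Q] [Module (ZMod 2) Q] [Finite Q]

/-- Some linear form takes the value `1` on at least half of a given family of nonzero vectors: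
each vector is mapped to `1` by exactly half of the linear forms. -/
theorem exists_dual_card_le {α : Type*} [Fintype α] (v : α → Q) (hv : ∀ a, v a ≠ 0) :
    ∃ φ : Dual (ZMod 2) Q,
      Fintype.card α ≤ 2 * (Finset.univ.filter fun a => φ (v a) = 1).card := by
  classical
  have : Finite (Dual (ZMod 2) Q) := DFunLike.finite _
  have := Fintype.ofFinite (Dual (ZMod 2) Q)
  have hhalf : ∀ a, Fintype.card (Dual (ZMod 2) Q) =
      2 * (Finset.univ.filter fun φ : Dual (ZMod 2) Q => φ (v a) = 1).card := by
    intro a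
    obtain ⟨φ₀, hφ₀⟩ : ∃ φ : Dual (ZMod 2) Q, φ (v a) ≠ 0 := by
      by_contra! hcon
      exact hv a ((Module.forall_dual_apply_eq_zero_iff (ZMod 2) (v a)).1 hcon)
    replace hφ₀ := ZMod.eq_one_of_ne_zero_two hφ₀
    have heq : (Finset.univ.filter fun φ : Dual (ZMod 2) Q => ¬ φ (v a) = 1).card =
        (Finset.univ.filter fun φ : Dual (ZMod 2) Q => φ (v a) = 1).card := by
      have key : ∀ z : ZMod 2, (z + 1 = 1 ↔ ¬ z = 1) := by decide
      refine Finset.card_bij' (fun φ _ => φ + φ₀) (fun φ _ => φ + φ₀) ?_ ?_ ?_ ?_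
      · intro φ hφ
        simpa [hφ₀, key] using hφ
      · intro φ hφ
        simp only [Finset.mem_filter, Finset.mem_univ, true_and] at hφ ⊢
        rw [LinearMap.add_apply, hφ₀, hφ]
        decide
      · intro φ _
        rw [add_assoc, ZModModule.add_self, add_zero]
      · intro φ _
        rw [add_assoc, ZModModule.add_self, add_zero]
    rw [← Finset.card_univ, ← Finset.card_filter_add_card_filter_not
      (fun φ : Dual (ZMod 2) Q => φ (v a) = 1), heq, two_mul]
  have hsum : ∑ _φ : Dual (ZMod 2) Q, Fintype.card α ≤
      ∑ φ : Dual (ZMod 2) Q, 2 * (Finset.univ.filter fun a => φ (v a) = 1).card := by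
    refine le_of_eq ?_
    calc ∑ _φ : Dual (ZMod 2) Q, Fintype.card α
        = ∑ _a : α, Fintype.card (Dual (ZMod 2) Q) := by
          simp [mul_comm]
      _ = ∑ a, ∑ φ : Dual (ZMod 2) Q, 2 * (if φ (v a) = 1 then 1 else 0) := by
          refine Finset.sum_congr rfl fun a _ => ?_
          rw [hhalf a, Finset.card_filter, Finset.mul_sum]
      _ = ∑ φ : Dual (ZMod 2) Q, ∑ a, 2 * (if φ (v a) = 1 then 1 else 0) := Finset.sum_comm
      _ = _ := by
          refine Finset.sum_congr rfl fun φ _ => ?_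
          rw [Finset.card_filter, Finset.mul_sum]
  obtain ⟨φ, _, hφ⟩ := Finset.exists_le_of_sum_le ⟨0, Finset.mem_univ _⟩ hsum
  exact ⟨φ, hφ⟩

/-- In dimension at least two there is an endomorphism `β` such that `β` and `1 + β` are invertible:
multiplication by an element other than `0` and `1` of a finite field of the right size. -/
theorem exists_end_bijective_add_one (hQ : 2 ≤ finrank (ZMod 2) Q) :
    ∃ β : Q →ₗ[ZMod 2] Q, Function.Injective β ∧
      Function.Surjective ((LinearMap.id : Q →ₗ[ZMod 2] Q) + β) := by
  have hfin : finrank (ZMod 2) (GaloisField 2 (finrank (ZMod 2) Q)) = finrank (ZMod 2) Q :=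
    GaloisField.finrank 2 (by omega)
  generalize hc : finrank (ZMod 2) Q = c at *
  have hcard : 2 < Nat.card (GaloisField 2 c) := by
    rw [GaloisField.card 2 c (by omega)]
    calc 2 < 2 ^ 2 := by norm_num
      _ ≤ 2 ^ c := Nat.pow_le_pow_right (by norm_num) hQ
  obtain ⟨x, hx0, hx1⟩ : ∃ x : GaloisField 2 c, x ≠ 0 ∧ x ≠ 1 := by
    by_contra! hcon
    have : (Set.univ : Set (GaloisField 2 c)) ⊆ {0, 1} := fun x _ => by
      by_cases h : x = 0
      · exact Or.inl h
      · exact Or.inr (hcon x h)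
    have h2 := Set.ncard_le_ncard this (Set.toFinite _)
    rw [Set.ncard_univ, Set.ncard_pair zero_ne_one] at h2
    omega
  have hne : 1 + x ≠ 0 := by
    intro h
    refine hx1 ?_
    have : x = -1 := by rw [eq_neg_iff_add_eq_zero, add_comm, h]
    rw [this, ZModModule.neg_eq_self]
  let e : Q ≃ₗ[ZMod 2] GaloisField 2 c := LinearEquiv.ofFinrankEq _ _ (by rw [hc, hfin])
  refine ⟨e.symm.toLinearMap ∘ₗ LinearMap.mulLeft (ZMod 2) x ∘ₗ e.toLinearMap, fun a b h => ?_,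
    fun b => ⟨e.symm ((1 + x)⁻¹ * e b), ?_⟩⟩
  · have h' : x * e a = x * e b := e.symm.injective h
    exact e.injective (mul_left_cancel₀ hx0 h')
  · apply e.injective
    have : e (e.symm ((1 + x)⁻¹ * e b) + e.symm (x * e (e.symm ((1 + x)⁻¹ * e b)))) =
        (1 + x) * ((1 + x)⁻¹ * e b) := by
      rw [map_add]
      simp only [LinearEquiv.apply_symm_apply]
      ring
    rw [mul_inv_cancel_left₀ hne] at this
    exact this

/-- Disjoint linear relations, found greedily: as long as more than `dim Q` vectors remain, some
`dim Q + 1` of them contain a nonempty subfamily with sum zero, which is removed. -/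
theorem exists_disjoint_sum_eq_zero {ι : Type*} [DecidableEq ι] (h : ι → Q) (R : Finset ι) :
    ∃ P : Finset (Finset ι), (∀ D ∈ P, D ⊆ R ∧ D.Nonempty ∧ ∑ i ∈ D, h i = 0) ∧
      (∀ D ∈ P, ∀ D' ∈ P, D ≠ D' → Disjoint D D') ∧
      R.card ≤ (finrank (ZMod 2) Q + 1) * P.card + finrank (ZMod 2) Q := by
  induction R using Finset.strongInduction with
  | H R ih =>
  by_cases hR : R.card ≤ finrank (ZMod 2) Q
  · exact ⟨∅, by simp, by simp, by simpa using hR⟩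
  obtain ⟨T, hTR, hT⟩ := Finset.exists_subset_card_eq (Nat.succ_le_of_lt (not_le.1 hR))
  have hdep : ¬ LinearIndepOn (ZMod 2) h (T : Set ι) := by
    intro hli
    have h1 : Fintype.card T ≤ finrank (ZMod 2) Q := LinearIndependent.fintype_card_le_finrank hli
    rw [Fintype.card_coe, hT] at h1
    omega
  rw [linearIndepOn_finset_iff] at hdep
  push Not at hdep
  obtain ⟨u, hu, i, hi, hui⟩ := hdep
  set D := T.filter fun i => u i ≠ 0 with hD
  have hDR : D ⊆ R := (Finset.filter_subset _ _).trans hTR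
  have hDne : D.Nonempty := ⟨i, Finset.mem_filter.2 ⟨hi, hui⟩⟩
  have hDsum : ∑ i ∈ D, h i = 0 := by
    rw [← hu, hD, Finset.sum_filter]
    refine Finset.sum_congr rfl fun j _ => ?_
    by_cases hj : u j = 0
    · simp [hj]
    · simp [ZMod.eq_one_of_ne_zero_two hj]
  have hDcard : D.card ≤ finrank (ZMod 2) Q + 1 := (Finset.card_filter_le _ _).trans hT.le
  obtain ⟨P, hP, hdisj, hcard⟩ := ih (R \ D) (Finset.sdiff_ssubset hDR hDne)
  have hDP : ∀ D' ∈ P, Disjoint D D' := fun D' hD' =>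
    (Finset.disjoint_of_subset_left (hP D' hD').1 Finset.sdiff_disjoint).symm
  have hnot : D ∉ P := fun hmem =>
    hDne.ne_empty (Finset.disjoint_self_iff_empty D |>.1 (hDP D hmem))
  refine ⟨insert D P, ?_, ?_, ?_⟩
  · intro D' hD'
    rcases Finset.mem_insert.1 hD' with rfl | hD'
    · exact ⟨hDR, hDne, hDsum⟩
    · exact ⟨(hP D' hD').1.trans Finset.sdiff_subset, (hP D' hD').2⟩
  · intro D₁ h₁ D₂ h₂ hne
    rcases Finset.mem_insert.1 h₁ with rfl | h₁ <;> rcases Finset.mem_insert.1 h₂ with rfl | h₂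
    · exact absurd rfl hne
    · exact hDP _ h₂
    · exact (hDP _ h₁).symm
    · exact hdisj _ h₁ _ h₂ hne
  · rw [Finset.card_insert_of_notMem hnot, mul_add, mul_one]
    have := Finset.card_sdiff_add_card_eq_card hDR
    omega

end TwoElements

/-! ### Capacity of the square of a function vanishing exactly on a subspace -/

/-- The indicator, as a bit, of `x` being nonzero. -/
noncomputable def nonzeroBit {Q : Type*} [Zero Q] (x : Q) : ZMod 2 :=
  open Classical in if x = 0 then 0 else 1

section NonzeroBit

variable {Q : Type*} [AddCommGroup Q]

@[simp] theorem nonzeroBit_zero : nonzeroBit (0 : Q) = 0 := by simp [nonzeroBit]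

theorem nonzeroBit_of_ne {x : Q} (h : x ≠ 0) : nonzeroBit x = 1 := by simp [nonzeroBit, h]

theorem nonzeroBit_eq_zero_iff {x : Q} : nonzeroBit x = 0 ↔ x = 0 := by
  by_cases h : x = 0 <;> simp [nonzeroBit, h]

/-- If all words in `Z` have an even number of nonzero entries, then `Z` has at most half of the full
dimension: at the only position where two words are both nonzero they must be equal, as otherwise
that position alone would make one of the three weights of `x`, `y` and `x + y` odd. -/
theorem two_mul_finrank_le_of_even_weight [Module (ZMod 2) Q] [Finite Q]
    (hQ : 2 ≤ finrank (ZMod 2) Q) (s : ℕ)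
    (Z : Submodule (ZMod 2) (Fin s → Q)) (hZ : ∀ x ∈ Z, ∑ i, nonzeroBit (x i) = 0) :
    2 * finrank (ZMod 2) Z ≤ s * finrank (ZMod 2) Q := by
  rw [two_mul]
  refine finrank_add_le_of_leading_eq_trailing hQ s Z Z fun i x hx y hy hxi hyi => ?_
  have hsum : ∑ k, (nonzeroBit (x k) + nonzeroBit (y k) + nonzeroBit (x k + y k)) = 0 := by
    rw [Finset.sum_add_distrib, Finset.sum_add_distrib, hZ x hx, hZ y hy]
    simpa using hZ (x + y) (Z.add_mem hx hy)
  rw [Finset.sum_eq_single i (fun k _ hk => ?_) (by simp)] at hsum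
  · by_contra! hcon
    obtain ⟨hx0, hy0, hne⟩ := hcon
    rw [nonzeroBit_of_ne hx0, nonzeroBit_of_ne hy0, ZModModule.add_self, zero_add,
      nonzeroBit_eq_zero_iff] at hsum
    exact hne (by rw [eq_neg_of_add_eq_zero_left hsum, ZModModule.neg_eq_self])
  · rcases lt_or_gt_of_ne hk with hk | hk
    · rw [hxi k hk, nonzeroBit_zero, zero_add, zero_add, ZModModule.add_self]
    · rw [hyi k hk, nonzeroBit_zero, add_zero, add_zero, ZModModule.add_self]

end NonzeroBit

section Pattern

variable {ι α Q : Type*} [DecidableEq ι] [Fintype α] [AddCommGroup Q] [Module (ZMod 2) Q]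

/-- Given disjoint sets `D a` of blocks, put into every block `i` of `D a` the lift under `σ` of the
image of `q a` under `ψ i`; the remaining blocks are zero. -/
noncomputable def patternMap (D : α → Finset ι) (σ : Q →ₗ[ZMod 2] ι → ZMod 2)
    (ψ : ι → Q →ₗ[ZMod 2] Q) : (α → Q) →ₗ[ZMod 2] (ι → ι → ZMod 2) :=
  LinearMap.pi fun i => ∑ a, if i ∈ D a then σ ∘ₗ ψ i ∘ₗ LinearMap.proj a else 0

theorem patternMap_apply_of_mem {D : α → Finset ι} (hD : ∀ a a', a ≠ a' → Disjoint (D a) (D a'))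
    (σ : Q →ₗ[ZMod 2] ι → ZMod 2) (ψ : ι → Q →ₗ[ZMod 2] Q) (q : α → Q) {i : ι} {a : α}
    (hi : i ∈ D a) : patternMap D σ ψ q i = σ (ψ i (q a)) := by
  simp only [patternMap, LinearMap.pi_apply, LinearMap.sum_apply]
  rw [Finset.sum_eq_single a (fun b _ hb => ?_) (by simp)]
  · simp [hi]
  · rw [if_neg (fun h => Finset.disjoint_left.1 (hD b a hb) h hi), LinearMap.zero_apply]

theorem patternMap_apply_of_notMem (D : α → Finset ι) (σ : Q →ₗ[ZMod 2] ι → ZMod 2)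
    (ψ : ι → Q →ₗ[ZMod 2] Q) (q : α → Q) {i : ι} (hi : ∀ a, i ∉ D a) :
    patternMap D σ ψ q i = 0 := by
  simp [patternMap, hi]

theorem sum_smul_eq_sum_parts [Fintype ι] {D : α → Finset ι}
    (hD : ∀ a a', a ≠ a' → Disjoint (D a) (D a')) (h : ι → Q) (c : ι → ZMod 2) (d : α → ZMod 2)
    (hc : ∀ a, ∀ i ∈ D a, c i = d a) (hc0 : ∀ i, (∀ a, i ∉ D a) → c i = 0) :
    ∑ i, c i • h i = ∑ a, d a • ∑ i ∈ D a, h i := by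
  have h1 : ∀ i, c i • h i = ∑ a, if i ∈ D a then d a • h i else 0 := by
    intro i
    by_cases hi : ∃ a, i ∈ D a
    · obtain ⟨a, ha⟩ := hi
      rw [Finset.sum_eq_single a (fun b _ hb => ?_) (by simp), if_pos ha, hc a i ha]
      exact if_neg fun hb' => Finset.disjoint_left.1 (hD b a hb) hb' ha
    · push Not at hi
      simp [hc0 i hi, hi]
  simp_rw [h1]
  rw [Finset.sum_comm]
  refine Finset.sum_congr rfl fun a _ => ?_
  rw [Finset.sum_ite_mem, Finset.univ_inter, Finset.smul_sum]

theorem LinearMap.apply_eq_sum_smul_single [Fintype ι] (π : (ι → ZMod 2) →ₗ[ZMod 2] Q)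
    (x : ι → ZMod 2) : π x = ∑ i, x i • π (Pi.single i 1) := by
  conv_lhs => rw [← Finset.univ_sum_single x, map_sum]
  refine Finset.sum_congr rfl fun i _ => ?_
  rw [← map_smul, ← Pi.single_smul, smul_eq_mul, mul_one]

theorem map_nonzeroBit_patternMap [Fintype ι] {D : α → Finset ι}
    (hD : ∀ a a', a ≠ a' → Disjoint (D a) (D a')) {π : (ι → ZMod 2) →ₗ[ZMod 2] Q}
    {σ : Q →ₗ[ZMod 2] ι → ZMod 2} (hσ : ∀ x, π (σ x) = x) {ψ : ι → Q →ₗ[ZMod 2] Q}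
    (hψ : ∀ i, Function.Injective (ψ i)) (q : α → Q) :
    π (fun i => nonzeroBit (π (patternMap D σ ψ q i))) =
      ∑ a, nonzeroBit (q a) • ∑ i ∈ D a, π (Pi.single i 1) := by
  rw [LinearMap.apply_eq_sum_smul_single]
  refine sum_smul_eq_sum_parts hD _ _ _ (fun a i hi => ?_) fun i hi => ?_
  · rw [patternMap_apply_of_mem hD σ ψ q hi, hσ]
    by_cases hq : q a = 0
    · simp [hq]
    · rw [nonzeroBit_of_ne hq, nonzeroBit_of_ne ((map_ne_zero_iff _ (hψ i)).2 hq)]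
  · simp [patternMap_apply_of_notMem D σ ψ q hi]

/-- If `f` vanishes exactly on the kernel of a map `π` onto `Q`, and the images under `π` of the unit
vectors satisfy disjoint linear relations `D a`, `a : α`, then `f ∘ f` has capacity at least
`|α| dim Q / 8`.

Filling the blocks of the relations by patterns yields zero subspaces of `f ∘ f`. Two of these, which
differ by the automorphism `β` in one main block of every relation, span together all inputs that
are supported on the main blocks (up to the choice of lifts). But a subspace on which `f ∘ f` vanishes
contains at most half, in dimension, of the inputs supported on suitably chosen main blocks, since
these correspond to words of even weight. Hence one of the two zero subspaces is far from being
contained in it. -/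
theorem hasCapacity_comp_self [Fintype ι] [Finite Q] {f : (ι → ZMod 2) → ZMod 2}
    {π : (ι → ZMod 2) →ₗ[ZMod 2] Q} (hπ : Function.Surjective π)
    (hf : ∀ x, f x = nonzeroBit (π x)) (hQ : 2 ≤ finrank (ZMod 2) Q) {D : α → Finset ι}
    (hD : ∀ a a', a ≠ a' → Disjoint (D a) (D a'))
    (hsum : ∀ a, ∑ i ∈ D a, π (Pi.single i 1) = 0) (main : α → ι) (hmain : ∀ a, main a ∈ D a)
    (hne : ∀ a, π (Pi.single (main a) 1) ≠ 0) :
    HasCapacity (fun y : ι → ι → ZMod 2 => f fun i => f (y i))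
      ((Fintype.card α * finrank (ZMod 2) Q + 7) / 8) := by
  classical
  obtain ⟨σ, hσ'⟩ := π.exists_rightInverse_of_surjective (LinearMap.range_eq_top.2 hπ)
  have hσ : ∀ x, π (σ x) = x := fun x => LinearMap.congr_fun hσ' x
  obtain ⟨β, hβ, hβ1⟩ := exists_end_bijective_add_one hQ
  have hff : ∀ y : ι → ι → ZMod 2, f (fun i => f (y i)) =
      nonzeroBit (π fun i => nonzeroBit (π (y i))) := fun y => by simp_rw [hf]
  have hmain_inj : Function.Injective main := by
    intro a a' h
    by_contra hcon
    exact Finset.disjoint_left.1 (hD a a' hcon) (hmain a) (h ▸ hmain a')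
  -- the lifts of all words on the main blocks lie in the span of the two zero subspaces
  let ψ : ι → Q →ₗ[ZMod 2] Q := fun i => if ∃ a, i = main a then β else LinearMap.id
  have hψ : ∀ i, Function.Injective (ψ i) := by
    intro i
    by_cases h : ∃ a, i = main a
    · simpa [ψ, h] using hβ
    · simpa [ψ, h] using Function.injective_id
  have hid : ∀ i : ι, Function.Injective
      ((fun _ => LinearMap.id : ι → Q →ₗ[ZMod 2] Q) i) := fun _ => Function.injective_id
  set κ₁ := patternMap D σ (fun _ => LinearMap.id) with hκ₁
  set κ₂ := patternMap D σ ψ with hκ₂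
  have hzero₁ : ∀ y ∈ κ₁.range, f (fun i => f (y i)) = 0 := by
    rintro _ ⟨q, rfl⟩
    rw [hff, map_nonzeroBit_patternMap hD hσ hid]
    simp [hsum]
  have hzero₂ : ∀ y ∈ κ₂.range, f (fun i => f (y i)) = 0 := by
    rintro _ ⟨q, rfl⟩
    rw [hff, map_nonzeroBit_patternMap hD hσ hψ]
    simp [hsum]
  have hDmain : ∀ a a', a ≠ a' → Disjoint ({main a} : Finset ι) {main a'} := by
    intro a a' h
    simpa using fun h' => h (hmain_inj h')
  have hspan : ∀ q : α → Q,
      patternMap (fun a => {main a}) σ (fun _ => LinearMap.id) q ∈ κ₁.range ⊔ κ₂.range := by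
    intro q
    choose p hp using fun a => hβ1 (q a)
    refine Submodule.mem_sup.2 ⟨κ₁ p, ⟨p, rfl⟩, κ₂ p, ⟨p, rfl⟩, funext fun i => ?_⟩
    rw [Pi.add_apply]
    by_cases hi : ∃ a, i ∈ D a
    · obtain ⟨a, ha⟩ := hi
      rw [hκ₁, hκ₂, patternMap_apply_of_mem hD σ _ p ha, patternMap_apply_of_mem hD σ _ p ha]
      by_cases him : ∃ a', i = main a'
      · obtain ⟨a', rfl⟩ := him
        have haa : a = a' := by
          by_contra hcon
          exact Finset.disjoint_left.1 (hD a a' hcon) ha (hmain a')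
        subst haa
        rw [patternMap_apply_of_mem hDmain σ _ q (Finset.mem_singleton_self _), ← hp a]
        simp [ψ]
      · rw [patternMap_apply_of_notMem _ σ _ q fun a' h => him ⟨a', Finset.mem_singleton.1 h⟩]
        simp only [ψ, him, if_false]
        exact ZModModule.add_self _
    · push Not at hi
      rw [hκ₁, hκ₂, patternMap_apply_of_notMem _ σ _ p hi, patternMap_apply_of_notMem _ σ _ p hi,
        patternMap_apply_of_notMem _ σ _ q fun a h => hi a (by
          rw [Finset.mem_singleton.1 h]
          exact hmain a), add_zero]
  refine ⟨?_, fun N => ?_⟩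
  · have h0 : f 0 = 0 := by rw [hf, map_zero, nonzeroBit_zero]
    change f (fun _ => f 0) = 0
    rw [h0]
    exact h0
  by_cases hN : ∃ y ∈ N, f (fun i => f (y i)) = 1
  · exact Or.inl hN
  right
  have hN0 : ∀ y ∈ N, f (fun i => f (y i)) = 0 := by
    intro y hy
    by_contra hcon
    exact hN ⟨y, hy, ZMod.eq_one_of_ne_zero_two hcon⟩
  -- a linear form turns membership in `N` into even weight on at least half of the main blocks
  obtain ⟨φ, hφ⟩ := exists_dual_card_le (fun a => π (Pi.single (main a) 1)) hne
  set I := Finset.univ.filter fun a => φ (π (Pi.single (main a) 1)) = 1 with hI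
  let e := I.equivFin.symm
  let D' : Fin I.card → Finset ι := fun k => {main (e k)}
  have hD' : ∀ k k', k ≠ k' → Disjoint (D' k) (D' k') := fun k k' h =>
    hDmain _ _ fun h' => h (e.injective (Subtype.ext h'))
  set ν := patternMap D' σ (fun _ => LinearMap.id) with hν
  have hνspan : ν.range ≤ κ₁.range ⊔ κ₂.range := by
    rintro _ ⟨q, rfl⟩
    convert hspan fun a => if h : a ∈ I then q (I.equivFin ⟨a, h⟩) else 0 using 1
    funext i
    by_cases hi : ∃ k, i ∈ D' k
    · obtain ⟨k, hk⟩ := hi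
      rw [hν, patternMap_apply_of_mem hD' σ _ q hk,
        patternMap_apply_of_mem hDmain σ _ _ (a := (e k : α)) hk]
      simp [e]
    · push Not at hi
      rw [hν, patternMap_apply_of_notMem _ σ _ q hi]
      by_cases hi' : ∃ a, i = main a
      · obtain ⟨a, rfl⟩ := hi'
        have ha : a ∉ I := fun h => hi (I.equivFin ⟨a, h⟩) (by simp [D', e])
        rw [patternMap_apply_of_mem hDmain σ _ _ (Finset.mem_singleton_self _)]
        simp [ha]
      · rw [patternMap_apply_of_notMem]
        exact fun a h => hi' ⟨a, Finset.mem_singleton.1 h⟩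
  have hZ := two_mul_finrank_le_of_even_weight hQ I.card (N.comap ν) (by
    intro x hx
    have h1 := hN0 (ν x) hx
    rw [hff, hν, map_nonzeroBit_patternMap hD' hσ hid, nonzeroBit_eq_zero_iff] at h1
    have h2 := congrArg φ h1
    rw [map_sum, map_zero] at h2
    rw [← h2]
    refine Finset.sum_congr rfl fun k _ => ?_
    have hk : φ (π (Pi.single (main (e k)) 1)) = 1 := (Finset.mem_filter.1 (e k).2).2
    rw [map_smul, Finset.sum_singleton, hk, smul_eq_mul, mul_one])
  -- dimensions modulo `N`
  have hrank := (N.mkQ ∘ₗ ν).finrank_range_add_finrank_ker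
  have hker : (N.mkQ ∘ₗ ν).ker = N.comap ν := by
    rw [LinearMap.ker_comp, Submodule.ker_mkQ]
  have hdimQ : finrank (ZMod 2) (Fin I.card → Q) = I.card * finrank (ZMod 2) Q := by
    rw [Module.finrank_pi_fintype]
    simp
  rw [hker, hdimQ, LinearMap.range_comp] at hrank
  have hle : finrank (ZMod 2) (ν.range.map N.mkQ) ≤
      finrank (ZMod 2) (κ₁.range.map N.mkQ) + finrank (ZMod 2) (κ₂.range.map N.mkQ) := by
    refine (Submodule.finrank_mono (Submodule.map_mono hνspan)).trans ?_
    rw [Submodule.map_sup]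
    exact Submodule.finrank_add_le_finrank_add_finrank _ _
  have hg₁ := finrank_map_add_finrank_inf_ker N.mkQ κ₁.range
  have hg₂ := finrank_map_add_finrank_inf_ker N.mkQ κ₂.range
  rw [Submodule.ker_mkQ] at hg₁ hg₂
  have hcard : Fintype.card α * finrank (ZMod 2) Q ≤ 2 * (I.card * finrank (ZMod 2) Q) := by
    rw [← mul_assoc]
    exact Nat.mul_le_mul_right _ hφ
  by_cases h : finrank (ZMod 2) (κ₂.range.map N.mkQ) ≤ finrank (ZMod 2) (κ₁.range.map N.mkQ)
  · exact ⟨κ₁.range, hzero₁, by omega⟩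
  · exact ⟨κ₂.range, hzero₂, by omega⟩

end Pattern

/-! ### The dichotomy on the span of the zeros -/

/-- If the zeros of `f` span a subspace on which `f` takes the value `1`, then any subspace on which
`f` vanishes misses a zero of `f`. -/
theorem hasCapacity_one {B : Type*} [AddCommGroup B] [Module (ZMod 2) B] [Finite B]
    {f : B → ZMod 2} (h0 : f 0 = 0)
    (h : ∃ x ∈ Submodule.span (ZMod 2) {x | f x = 0}, f x = 1) : HasCapacity f 1 := by
  refine ⟨h0, fun N => ?_⟩
  by_cases hN : {x | f x = 0} ⊆ (N : Set B)
  · obtain ⟨x, hx, hx1⟩ := h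
    exact Or.inl ⟨x, Submodule.span_le.2 hN hx, hx1⟩
  obtain ⟨u, hu, huN⟩ := Set.not_subset.1 hN
  have hsmul : ∀ a : ZMod 2, a = 0 ∨ a = 1 := by decide
  refine Or.inr ⟨Submodule.span (ZMod 2) {u}, fun y hy => ?_, ?_⟩
  · obtain ⟨a, rfl⟩ := Submodule.mem_span_singleton.1 hy
    rcases hsmul a with rfl | rfl
    · rwa [zero_smul]
    · rwa [one_smul]
  · have hbot : Submodule.span (ZMod 2) {u} ⊓ N = ⊥ := by
      refine (Submodule.eq_bot_iff _).2 fun y hy => ?_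
      obtain ⟨a, rfl⟩ := Submodule.mem_span_singleton.1 hy.1
      rcases hsmul a with rfl | rfl
      · rw [zero_smul]
      · exact absurd (by simpa using hy.2) huN
    have hu0 : u ≠ 0 := fun h => huN (h ▸ N.zero_mem)
    rw [hbot, finrank_bot, finrank_span_singleton hu0]

theorem isParity_of_linear {ι : Type*} [Fintype ι] {f : (ι → ZMod 2) → ZMod 2}
    (φ : (ι → ZMod 2) →ₗ[ZMod 2] ZMod 2) (h : ∀ x, f x = φ x) : IsParity f := by
  classical
  refine ⟨Finset.univ.filter fun i => φ (Pi.single i 1) = 1, fun x => ?_⟩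
  rw [h, LinearMap.apply_eq_sum_smul_single, Finset.sum_filter]
  refine Finset.sum_congr rfl fun i _ => ?_
  by_cases hi : φ (Pi.single i 1) = 1
  · simp [hi]
  · have : φ (Pi.single i 1) = 0 := by
      by_contra hcon
      exact hi (ZMod.eq_one_of_ne_zero_two hcon)
    simp [this]

section Quotient

variable {ι Q : Type*} [Fintype ι] [AddCommGroup Q] [Module (ZMod 2) Q]
  {f : (ι → ZMod 2) → ZMod 2} {π : (ι → ZMod 2) →ₗ[ZMod 2] Q}

/-- In dimension at most one, `nonzeroBit` is linear. -/
theorem two_le_finrank_of_not_isParity [Finite Q] (hf : ∀ x, f x = nonzeroBit (π x))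
    (hpar : ¬ IsParity f) :
    2 ≤ finrank (ZMod 2) Q := by
  by_contra hlt
  obtain ⟨v, hv⟩ := finrank_le_one_iff.1 (show finrank (ZMod 2) Q ≤ 1 by omega)
  by_cases hv0 : v = 0
  · refine hpar (isParity_of_linear 0 fun x => ?_)
    obtain ⟨a, ha⟩ := hv (π x)
    rw [hf, ← ha, hv0, smul_zero, nonzeroBit_zero, LinearMap.zero_apply]
  · obtain ⟨φ, hφ⟩ : ∃ φ : Dual (ZMod 2) Q, φ v ≠ 0 := by
      by_contra! hcon
      exact hv0 ((Module.forall_dual_apply_eq_zero_iff (ZMod 2) v).1 hcon)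
    replace hφ := ZMod.eq_one_of_ne_zero_two hφ
    refine hpar (isParity_of_linear (φ ∘ₗ π) fun x => ?_)
    obtain ⟨a, ha⟩ := hv (π x)
    rw [hf, LinearMap.comp_apply, ← ha, map_smul, hφ, smul_eq_mul, mul_one]
    by_cases ha0 : a = 0
    · rw [ha0, zero_smul, nonzeroBit_zero]
    · rw [nonzeroBit_of_ne (smul_ne_zero ha0 hv0), ZMod.eq_one_of_ne_zero_two ha0]

variable [DecidableEq ι] [DecidableEq Q]

theorem LinearMap.apply_eq_sum_filter (x : ι → ZMod 2) :
    π x = ∑ i ∈ Finset.univ.filter fun i => π (Pi.single i 1) ≠ 0, x i • π (Pi.single i 1) := by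
  rw [LinearMap.apply_eq_sum_smul_single, Finset.sum_filter]
  refine Finset.sum_congr rfl fun i _ => ?_
  by_cases hi : π (Pi.single i 1) = 0 <;> simp [hi]

theorem certComplexity_le_card_filter (hf : ∀ x, f x = nonzeroBit (π x)) :
    certComplexity f 0 ≤ (Finset.univ.filter fun i => π (Pi.single i 1) ≠ 0).card := by
  refine certComplexity_le _ fun z hz => ?_
  rw [hf, hf, LinearMap.apply_eq_sum_filter (π := π) z, map_zero]
  refine congrArg nonzeroBit (Finset.sum_eq_zero fun i hi => ?_)
  rw [hz i hi, Pi.zero_apply, zero_smul]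

/-- The nonzero images of unit vectors span `Q`, so if there are at most `dim Q` of them, they are
independent. -/
theorem linearIndepOn_of_card_le [Finite Q] (hπ : Function.Surjective π)
    (hcard : (Finset.univ.filter fun i => π (Pi.single i 1) ≠ 0).card ≤ finrank (ZMod 2) Q) :
    LinearIndepOn (ZMod 2) (fun i => π (Pi.single i 1))
      ((Finset.univ.filter fun i => π (Pi.single i 1) ≠ 0 : Finset ι) : Set ι) := by
  set R := Finset.univ.filter fun i => π (Pi.single i 1) ≠ 0 with hR
  have hli : LinearIndependent (ZMod 2) (fun i : R => π (Pi.single (i : ι) 1)) := by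
    rw [linearIndependent_iff_card_le_finrank_span, Fintype.card_coe]
    have htop : Submodule.span (ZMod 2) (Set.range fun i : R => π (Pi.single (i : ι) 1)) = ⊤ := by
      refine (Submodule.eq_top_iff'.2 fun q => ?_)
      obtain ⟨x, rfl⟩ := hπ q
      rw [LinearMap.apply_eq_sum_filter (π := π) x]
      exact Submodule.sum_mem _ fun i hi =>
        Submodule.smul_mem _ _ (Submodule.subset_span ⟨⟨i, hi⟩, rfl⟩)
    rw [Set.finrank, htop, finrank_top]
    exact hcard
  exact hli

/-- If there are more relevant variables than the dimension of `Q`, then the capacity of `f ∘ f` is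
at least proportional to their number. -/
theorem exists_hasCapacity_comp_self [Finite Q] (hπ : Function.Surjective π)
    (hf : ∀ x, f x = nonzeroBit (π x)) (hQ : 2 ≤ finrank (ZMod 2) Q)
    (hcard : finrank (ZMod 2) Q < (Finset.univ.filter fun i => π (Pi.single i 1) ≠ 0).card) :
    ∃ t, (Finset.univ.filter fun i => π (Pi.single i 1) ≠ 0).card ≤ 24 * t ∧
      HasCapacity (fun y : ι → ι → ZMod 2 => f fun i => f (y i)) t := by
  obtain ⟨P, hP, hdisj, hle⟩ := exists_disjoint_sum_eq_zero (fun i => π (Pi.single i 1))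
    (Finset.univ.filter fun i => π (Pi.single i 1) ≠ 0)
  choose main hmain using fun D : P => (hP D D.2).2.1
  refine ⟨_, ?_, hasCapacity_comp_self (α := P) (D := fun D => D) hπ hf hQ
    (fun D D' h => hdisj D D.2 D' D'.2 fun h' => h (Subtype.ext h'))
    (fun D => (hP D D.2).2.2) main hmain
    fun D => (Finset.mem_filter.1 ((hP D D.2).1 (hmain D))).2⟩
  -- with `p` relations and `c = dim Q ≥ 2`, the number of variables is at most `(c + 1) p + c`,
  -- hence at most `3 p c`, while the capacity is at least `p c / 8`
  rw [Fintype.card_coe]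
  have hpos : 1 ≤ P.card := by
    by_contra hcon
    have : P.card = 0 := by omega
    rw [this] at hle
    omega
  have h1 : finrank (ZMod 2) Q ≤ P.card * finrank (ZMod 2) Q := Nat.le_mul_of_pos_left _ hpos
  have h2 : P.card ≤ P.card * finrank (ZMod 2) Q := Nat.le_mul_of_pos_right _ (by omega)
  have h3 : (finrank (ZMod 2) Q + 1) * P.card = P.card * finrank (ZMod 2) Q + P.card := by ring
  omega

end Quotient

/-! ### Powers of functions vanishing exactly on a coordinate subspace -/

section Coordinate

variable {n : ℕ} {f : (Fin n → ZMod 2) → ZMod 2} {R : Finset (Fin n)}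

theorem boolPow_eq_zero_iff (hf : ∀ x, f x = 0 ↔ ∀ i ∈ R, x i = 0) :
    ∀ (k : ℕ) (y : (Fin k → Fin n) → ZMod 2),
      boolPow f k y = 0 ↔ ∀ w : Fin k → Fin n, (∀ l, w l ∈ R) → y w = 0
  | 0, y => ⟨fun h w _ => by rw [Subsingleton.elim w Fin.elim0]; exact h,
      fun h => h _ fun l => l.elim0⟩
  | k + 1, y => by
    change f (fun i => boolPow f k fun w => y (Fin.cons i w)) = 0 ↔ _
    simp only [hf, boolPow_eq_zero_iff hf k]
    constructor
    · intro h w hw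
      rw [← Fin.cons_self_tail w]
      exact h _ (hw 0) _ fun l => hw l.succ
    · intro h i hi w hw
      refine h _ fun l => ?_
      refine Fin.cases ?_ (fun l => ?_) l
      · simpa using hi
      · simpa using hw l

theorem card_pow_le_parityCertComplexity (hf : ∀ x, f x = 0 ↔ ∀ i ∈ R, x i = 0) (k : ℕ) :
    R.card ^ k ≤ parityCertComplexity (boolPow f k) 0 := by
  obtain ⟨V, hV, hd⟩ := exists_parityCertificate (boolPow f k)
  rw [← hd]
  let r : (Fin k → R) → Fin k → Fin n := fun v l => v l
  have hr : Function.Injective r := fun v v' h =>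
    funext fun l => Subtype.ext (congrFun h l)
  have hsurj := LinearMap.funLeft_surjective_of_injective (ZMod 2) (ZMod 2) r hr
  have h0 : boolPow f k 0 = 0 := (boolPow_eq_zero_iff hf k 0).2 fun _ _ => rfl
  have hle : V ≤ (LinearMap.funLeft (ZMod 2) (ZMod 2) r).ker := fun v hv =>
    funext fun w => (boolPow_eq_zero_iff hf k v).1 ((hV v hv).trans h0) _ fun l => (w l).2
  have h1 := Submodule.finrank_mono hle
  have h2 := (LinearMap.funLeft (ZMod 2) (ZMod 2) r).finrank_range_add_finrank_ker
  have h3 := Submodule.finrank_quotient_add_finrank V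
  rw [LinearMap.range_eq_top.2 hsurj, finrank_top, finrank_fintype_fun_eq_card,
    Fintype.card_fun, Fintype.card_coe, Fintype.card_fin] at h2
  omega

end Coordinate

theorem one_le_parityCertComplexity_boolPow_one {n : ℕ} {f : (Fin n → ZMod 2) → ZMod 2}
    (h0 : f 0 = 0) (hpar : ¬ IsParity f) : 1 ≤ parityCertComplexity (boolPow f 1) 0 := by
  by_contra hlt
  obtain ⟨V, hV, hd⟩ := exists_parityCertificate (boolPow f 1)
  have htop : V = ⊤ := by
    refine Submodule.eq_top_of_finrank_eq ?_
    have := Submodule.finrank_quotient_add_finrank V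
    omega
  refine hpar ⟨∅, fun x => ?_⟩
  rw [← boolPow_one f x, hV _ (htop ▸ Submodule.mem_top), boolPow_zero_arg f h0, Finset.sum_empty]

/-- The lower bound with constant `1 / 24`. If `f` takes the value `1` on the span of its zeros,
single copies of `f` serve as blocks; otherwise `f` vanishes exactly on a subspace `U`, and the
relevant variables either are independent modulo `U` or satisfy many disjoint relations. -/
theorem certComplexity_pow_le_mul_parityCertComplexity {n : ℕ} {f : (Fin n → ZMod 2) → ZMod 2}
    (h0 : f 0 = 0) (hpar : ¬ IsParity f) : ∀ k, 1 ≤ k →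
    certComplexity f 0 ^ (k - 1) ≤ 24 * parityCertComplexity (boolPow f k) 0
  | 1, _ => by
    have := one_le_parityCertComplexity_boolPow_one h0 hpar
    rw [Nat.sub_self, pow_zero]
    omega
  | a + 2, _ => by
    classical
    rw [show a + 2 - 1 = a + 1 from rfl]
    by_cases hU : ∃ x ∈ Submodule.span (ZMod 2) {x | f x = 0}, f x = 1
    · have := (hasCapacity_one h0 hU).le_parityCertComplexity_boolPow f h0 (a + 1)
      rw [one_mul] at this
      exact this.trans (Nat.le_mul_of_pos_left _ (by norm_num))
    set U := Submodule.span (ZMod 2) {x | f x = 0} with hUdef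
    have hf : ∀ x, f x = nonzeroBit (U.mkQ x) := by
      intro x
      by_cases hx : f x = 0
      · have : U.mkQ x = 0 := by
          rw [Submodule.mkQ_apply, Submodule.Quotient.mk_eq_zero]
          exact Submodule.subset_span hx
        rw [hx, this, nonzeroBit_zero]
      · have hx1 := ZMod.eq_one_of_ne_zero_two hx
        rw [hx1, nonzeroBit_of_ne]
        rw [Submodule.mkQ_apply, Ne, Submodule.Quotient.mk_eq_zero]
        exact fun hxU => hU ⟨x, hxU, hx1⟩
    have hπ := U.mkQ_surjective
    have hQ := two_le_finrank_of_not_isParity hf hpar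
    have hC := certComplexity_le_card_filter hf
    by_cases hcard : (Finset.univ.filter fun i => U.mkQ (Pi.single i 1) ≠ 0).card ≤
        finrank (ZMod 2) ((Fin n → ZMod 2) ⧸ U)
    · have hli := linearIndepOn_of_card_le hπ hcard
      rw [linearIndepOn_finset_iff] at hli
      set R := Finset.univ.filter fun i => U.mkQ (Pi.single i 1) ≠ 0
      have hfR : ∀ x, f x = 0 ↔ ∀ i ∈ R, x i = 0 := by
        intro x
        rw [hf, nonzeroBit_eq_zero_iff, LinearMap.apply_eq_sum_filter (π := U.mkQ) x]
        refine ⟨hli x, fun h => Finset.sum_eq_zero fun i hi => ?_⟩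
        rw [h i hi, zero_smul]
      have hR := card_pow_le_parityCertComplexity hfR (a + 2)
      have hRpos : 0 < R.card := by
        refine Finset.card_pos.2 (Finset.nonempty_iff_ne_empty.2 fun hempty => hpar ⟨∅, fun x => ?_⟩)
        rw [Finset.sum_empty, hfR, hempty]
        simp
      calc certComplexity f 0 ^ (a + 1) ≤ R.card ^ (a + 1) := Nat.pow_le_pow_left hC _
        _ ≤ R.card ^ (a + 2) := Nat.pow_le_pow_right hRpos (Nat.le_succ _)
        _ ≤ parityCertComplexity (boolPow f (a + 2)) 0 := hR
        _ ≤ _ := Nat.le_mul_of_pos_left _ (by norm_num)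
    · obtain ⟨t, ht, hcap⟩ := exists_hasCapacity_comp_self hπ hf hQ (not_le.1 hcard)
      have := hcap.le_parityCertComplexity_boolPow_add_two f h0 a
      calc certComplexity f 0 ^ (a + 1) = certComplexity f 0 * certComplexity f 0 ^ a := pow_succ' _ _
        _ ≤ 24 * t * certComplexity f 0 ^ a := Nat.mul_le_mul_right _ (hC.trans ht)
        _ = 24 * (t * certComplexity f 0 ^ a) := mul_assoc _ _ _
        _ ≤ _ := Nat.mul_le_mul_left _ this

theorem theorem5 :
    ∃ c : ℝ, 0 < c ∧
      ∀ (n : ℕ) (f : (Fin n → ZMod 2) → ZMod 2), f 0 = 0 → ¬ IsParity f →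
        ∀ k : ℕ, 1 ≤ k →
          c * (certComplexity f 0 : ℝ) ^ (k - 1) ≤ (parityCertComplexity (boolPow f k) 0 : ℝ) ∧
          parityCertComplexity (boolPow f k) 0 ≤ parityDT (boolPow f k) := by
  refine ⟨1 / 24, by norm_num, fun n f h0 hpar k hk => ⟨?_, parityCertComplexity_le_parityDT _⟩⟩
  have h : (certComplexity f 0 : ℝ) ^ (k - 1) ≤ 24 * parityCertComplexity (boolPow f k) 0 := by
    exact_mod_cast certComplexity_pow_le_mul_parityCertComplexity h0 hpar k hk
  linarith
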